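/- Let $E$ and $F$ be real Banach lattices, and suppose that $F$ is Dedekind complete (every nonempty subset of $F$ that is bounded above has a supremum) and that $c_0$ does not embed in $F$ (there is no bounded linear map $c_0\to F$ that is a homeomorphism onto its range). Let $T:E\to F$ be an order bounded linear operator, that is, a linear map that sends order bounded subsets of $E$ to order bounded subsets of $F$. Then the modulus $|T|$, i.e. the supremum of $\{T,-T\}$ in the space of all linear operators $E\to F$ ordered by $S\le R$ iff $(R-S)x\ge 0$ for all $x\ge 0$, exists, and both $T$ and $|T|$ are b-weakly compact. Here a linear operator $S:E\to F$ is called b-weakly compact if $S(A)$ is relatively weakly compact in $F$ for every b-order bounded set $A\subseteq E$, where $A$ is b-order bounded if its canonical image in the topological bidual $E''$ is contained in an order interval of $E''$ (with $\varphi\le\psi$ in $E''$ iff $\varphi(f)\le\psi(f)$ for every positive $f\in E'$). -/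

import Mathlib

open scoped ZeroAtInfty

/-- A partially ordered set is Dedekind complete if every nonempty subset that is bounded above
has a supremum. -/
def IsDedekindComplete (F : Type*) [Preorder F] : Prop :=
  ∀ s : Set F, s.Nonempty → BddAbove s → ∃ a, IsLUB s a

/-- The Banach space `c₀` of real null sequences, with the supremum norm, embeds in `F`: there is a
bounded linear map from `c₀` to `F` that is a homeomorphism onto its range. -/
def CZeroEmbeds (F : Type*) [NormedAddCommGroup F] [NormedSpace ℝ F] : Prop :=
  ∃ J : C₀(ℕ, ℝ) →L[ℝ] F, Topology.IsEmbedding J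

/-- A subset of an ordered space is order bounded if it is bounded above and below, that is, if it
lies in an order interval. -/
def IsOrderBoundedSet {E : Type*} [Preorder E] (A : Set E) : Prop :=
  ∃ a b : E, A ⊆ Set.Icc a b

section Operators

variable {E F : Type*} [AddCommGroup E] [Module ℝ E] [AddCommGroup F] [Module ℝ F]

/-- A linear operator is order bounded if it maps order bounded sets to order bounded sets. -/
def IsOrderBoundedOperator [Preorder E] [Preorder F] (T : E →ₗ[ℝ] F) : Prop :=
  ∀ A : Set E, IsOrderBoundedSet A → IsOrderBoundedSet (T '' A)

/-- The order of the space of all linear operators: `S ≤ T` if `T - S` is positive. -/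
def OperatorLE [Preorder E] [Preorder F] (S T : E →ₗ[ℝ] F) : Prop :=
  ∀ x : E, 0 ≤ x → 0 ≤ (T - S) x

/-- `R` is the modulus of `T`: the supremum of `{T, -T}` in the ordered vector space of all linear
operators from `E` to `F`. -/
structure IsOperatorModulus [Preorder E] [Preorder F] (T R : E →ₗ[ℝ] F) : Prop where
  le : OperatorLE T R
  neg_le : OperatorLE (-T) R
  least : ∀ S : E →ₗ[ℝ] F, OperatorLE T S → OperatorLE (-T) S → OperatorLE R S

end Operators

section BOrderBounded

variable {E : Type*} [NormedAddCommGroup E] [NormedSpace ℝ E] [Preorder E]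

/-- Positivity of a functional in the norm dual. -/
def DualNonneg (f : StrongDual ℝ E) : Prop :=
  ∀ x : E, 0 ≤ x → 0 ≤ f x

/-- The order of the bidual: `φ ≤ ψ` if `φ f ≤ ψ f` for all positive functionals `f`. -/
def BidualLE (φ ψ : StrongDual ℝ (StrongDual ℝ E)) : Prop :=
  ∀ f : StrongDual ℝ E, DualNonneg f → φ f ≤ ψ f

/-- A subset of `E` is b-order bounded if its canonical image in the bidual lies in an order
interval of the bidual. -/
def IsBOrderBounded (A : Set E) : Prop :=
  ∃ φ ψ : StrongDual ℝ (StrongDual ℝ E), ∀ x ∈ A,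
    BidualLE φ (NormedSpace.inclusionInDoubleDual ℝ E x) ∧
      BidualLE (NormedSpace.inclusionInDoubleDual ℝ E x) ψ

/-- A subset of a normed space is relatively weakly compact if its closure in the weak topology is
compact in the weak topology. -/
def IsRelativelyWeaklyCompact {X : Type*} [NormedAddCommGroup X] [NormedSpace ℝ X]
    (B : Set X) : Prop :=
  IsCompact (closure (toWeakSpace ℝ X '' B))

/-- A linear operator is b-weakly compact if it maps b-order bounded sets to relatively weakly
compact sets. -/
def IsBWeaklyCompact {X : Type*} [NormedAddCommGroup X] [NormedSpace ℝ X]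
    (T : E →ₗ[ℝ] X) : Prop :=
  ∀ A : Set E, IsBOrderBounded A → IsRelativelyWeaklyCompact (T '' A)

end BOrderBounded

/-! Since `F` is Dedekind complete, the modulus `R` of `T` exists by Riesz–Kantorovich, and `T = R -
(R - T)` is a difference of positive operators. It therefore suffices that a positive operator sends
b-order bounded sets to order bounded sets, and that order bounded sets of `F` are relatively weakly
compact.

Both facts rest on monotone convergence: without a copy of `c₀`, a norm bounded directed subset of
`F` has a bound in its norm closure (`exists_mem_upperBounds_closure_of_directedOn`). Otherwise
there would be positive vectors with norms bounded below and bounded finite sums, and Rosenthal's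
disjointification would extract a copy of `c₀`.

For the first fact, the elements of `E` lying in an order interval of `E''` form a norm bounded
sublattice, so their image under a positive, hence continuous, operator is norm bounded and directed
both ways.

For the second, let an ultrafilter live on `[0, u]`. A positive functional `f` gives the seminorm `f
|·|`, for which `[0, u]` is complete. An order-valued substitute for `z² / u` supplies uniform
convexity, so the convex members of the ultrafilter have a common cluster point, which represents
the limits of all functionals dominated by `f`. Least solutions for each `f` increase with `f`, and
their norm limit is the weak limit. -/

open Filter Topology

set_option linter.unusedSectionVars false

/-! ### Vector lattice preliminaries -/

section Lattice

variable {E : Type*} [AddCommGroup E] [Lattice E] [IsOrderedAddMonoid E] [Module ℝ E]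
  [IsOrderedModule ℝ E]

theorem smul_posPart_of_nonneg {c : ℝ} (hc : 0 ≤ c) (x : E) : (c • x)⁺ = c • x⁺ := by
  rcases hc.eq_or_lt with rfl | hc
  · simp
  · exact ((OrderIso.smulRight hc).map_sup x 0 |>.trans (by simp [posPart_def])).symm

theorem posPart_add_le (x y : E) : (x + y)⁺ ≤ x⁺ + y⁺ :=
  sup_le (add_le_add (le_posPart x) (le_posPart y))
    (add_nonneg (posPart_nonneg x) (posPart_nonneg y))

theorem le_of_sub_eq_sub {a b c d : E} (h : c ≤ d) (e : d - c = b - a) : a ≤ b :=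
  sub_nonneg.1 (e ▸ sub_nonneg.2 h)

/-- Riesz decomposition for the absolute value. -/
theorem exists_abs_le_decomposition {x y z : E} (hx : 0 ≤ x) (hy : 0 ≤ y) (h : |z| ≤ x + y) :
    ∃ z₁ z₂ : E, |z₁| ≤ x ∧ |z₂| ≤ y ∧ z = z₁ + z₂ := by
  have h1 : z ≤ x + y := (le_abs_self z).trans h
  have h2 : -z ≤ x + y := (neg_le_abs z).trans h
  -- The first summand is `z` truncated to `[-x, x]`.
  refine ⟨(z ⊓ x) ⊔ (-x), z - (z ⊓ x) ⊔ (-x), ?_, ?_, by abel⟩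
  · exact abs_le'.2 ⟨sup_le inf_le_right ((neg_nonpos.2 hx).trans hx), by
      rw [neg_le]; exact le_sup_right⟩
  · refine abs_le'.2 ⟨?_, ?_⟩
    · have : z - y ≤ z ⊓ x := le_inf (sub_le_self z hy) (sub_le_iff_le_add.2 h1)
      exact le_of_sub_eq_sub (this.trans (le_sup_left (b := -x))) (by abel)
    · have : (z ⊓ x) ⊔ (-x) ≤ z + y :=
        sup_le (inf_le_left.trans (le_add_of_nonneg_right hy)) (le_of_sub_eq_sub h2 (by abel))
      exact le_of_sub_eq_sub this (by abel)

theorem nonneg_linearMap_monotone {F : Type*} [AddCommGroup F] [Preorder F]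
    [IsOrderedAddMonoid F] [Module ℝ F] {S : E →ₗ[ℝ] F} (hS : ∀ x, 0 ≤ x → 0 ≤ S x) :
    Monotone S := fun x y h => by
  have := hS (y - x) (sub_nonneg.2 h)
  rwa [map_sub, sub_nonneg] at this

end Lattice

/-! ### Positive functionals from Hahn–Banach -/

section Functionals

theorem exists_linearMap_le_sublinear {E : Type*} [AddCommGroup E] [Module ℝ E] {p : E → ℝ}
    (hom : ∀ c : ℝ, 0 < c → ∀ x, p (c • x) = c * p x) (hadd : ∀ x y, p (x + y) ≤ p x + p y)
    {x : E} {c : ℝ} (hc : ∀ t : ℝ, t * c ≤ p (t • x)) :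
    ∃ g : E →ₗ[ℝ] ℝ, g x = c ∧ ∀ y, g y ≤ p y := by
  have p0 : p 0 = 0 := by
    have := hom 2 two_pos 0
    rw [smul_zero] at this
    linarith
  have H : ∀ t : ℝ, t • x = 0 → t • c = 0 := fun t ht => by
    have h1 := hc t
    have h2 := hc (-t)
    rw [neg_smul, ht, neg_zero, p0] at h2
    rw [ht, p0] at h1
    rw [smul_eq_mul]
    linarith
  obtain ⟨g, hg, hgp⟩ := exists_extension_of_le_sublinear (LinearPMap.mkSpanSingleton' x c H) p
    hom hadd (by
      rintro ⟨y, hy⟩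
      obtain ⟨t, rfl⟩ := Submodule.mem_span_singleton.1 hy
      rw [LinearPMap.mkSpanSingleton'_apply]
      exact hc t)
  refine ⟨g, ?_, hgp⟩
  have := hg ⟨x, Submodule.mem_span_singleton_self x⟩
  exact this.trans (LinearPMap.mkSpanSingleton'_apply_self x c H _)

variable {E : Type*} [NormedAddCommGroup E] [NormedSpace ℝ E] [Lattice E] [IsOrderedAddMonoid E]
  [IsOrderedModule ℝ E] [HasSolidNorm E]

/-- Hahn–Banach is applied to `y ↦ q y⁺`. This sublinear map vanishes on the negative cone, which
forces the extension to be positive. The choice `q = ‖·‖` gives norming functionals, and `q = f`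
gives the Riesz–Kantorovich formula for `f x⁺`. -/
theorem exists_dualNonneg_le_apply_eq {q : E → ℝ} {C : ℝ}
    (hom : ∀ c : ℝ, 0 < c → ∀ x, q (c • x) = c * q x) (hadd : ∀ x y, q (x + y) ≤ q x + q y)
    (hmono : ∀ x y, 0 ≤ x → x ≤ y → q x ≤ q y) (hC : ∀ x, q x ≤ C * ‖x‖) (x : E) :
    ∃ g : StrongDual ℝ E, DualNonneg g ∧ (∀ y, 0 ≤ y → g y ≤ q y) ∧ g x = q x⁺ := by
  have q0 : q 0 = 0 := by
    have := hom 2 two_pos 0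
    rw [smul_zero] at this
    linarith
  have qn : ∀ y, 0 ≤ y → 0 ≤ q y := fun y hy => q0 ▸ hmono 0 y le_rfl hy
  obtain ⟨g, hgx, hg⟩ := exists_linearMap_le_sublinear (p := fun y => q y⁺) (x := x) (c := q x⁺)
    (fun c hc y => by simp only [smul_posPart_of_nonneg hc.le, hom c hc])
    (fun y z => (hmono _ _ (posPart_nonneg _) (posPart_add_le y z)).trans (hadd _ _))
    (fun t => by
      rcases lt_or_ge 0 t with ht | ht
      · simp only [smul_posPart_of_nonneg ht.le, hom t ht, le_refl]
      · exact (mul_nonpos_of_nonpos_of_nonneg ht (qn _ (posPart_nonneg _))).trans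
          (qn _ (posPart_nonneg _)))
  have gn : ∀ y, 0 ≤ y → 0 ≤ g y := fun y hy => by
    have := hg (-y)
    simp only [posPart_eq_zero.2 (neg_nonpos.2 hy), q0, map_neg] at this
    linarith
  have gq : ∀ y, 0 ≤ y → g y ≤ q y := fun y hy => by
    have := hg y
    simpa only [posPart_eq_self.2 hy] using this
  have gm := nonneg_linearMap_monotone gn
  refine ⟨g.mkContinuous C fun y => ?_, gn, gq, hgx⟩
  have h1 := gq |y| (abs_nonneg y)
  have h2 := hC |y|
  rw [norm_abs_eq_norm] at h2
  have h3 := gm (le_abs_self y)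
  have h4 := gm (neg_le_abs y)
  rw [map_neg] at h4
  exact abs_le'.2 ⟨by linarith, by linarith⟩

theorem DualNonneg.monotone {f : StrongDual ℝ E} (hf : DualNonneg f) : Monotone f :=
  nonneg_linearMap_monotone (S := f.toLinearMap) hf

theorem DualNonneg.add {f g : StrongDual ℝ E} (hf : DualNonneg f) (hg : DualNonneg g) :
    DualNonneg (f + g) := fun x hx => add_nonneg (hf x hx) (hg x hx)

theorem exists_dualNonneg_apply_eq_norm_posPart (x : E) :
    ∃ g : StrongDual ℝ E, DualNonneg g ∧ ‖g‖ ≤ 1 ∧ g x = ‖x⁺‖ := by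
  obtain ⟨g, hg, hle, hx⟩ := exists_dualNonneg_le_apply_eq (q := fun y : E => ‖y‖) (C := 1)
    (fun c hc y => by simp [norm_smul, abs_of_pos hc]) norm_add_le
    (fun y z hy h => norm_le_norm_of_abs_le_abs (by
      rwa [abs_of_nonneg hy, abs_of_nonneg (hy.trans h)])) (fun y => by simp) x
  refine ⟨g, hg, g.opNorm_le_bound zero_le_one fun y => ?_, hx⟩
  have h1 := hle |y| (abs_nonneg y)
  rw [norm_abs_eq_norm] at h1
  have h3 := hg.monotone (le_abs_self y)
  have h4 := hg.monotone (neg_le_abs y)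
  rw [map_neg] at h4
  exact abs_le'.2 ⟨by linarith, by linarith⟩

theorem DualNonneg.exists_le_apply_eq_posPart {f : StrongDual ℝ E} (hf : DualNonneg f) (x : E) :
    ∃ g : StrongDual ℝ E, DualNonneg g ∧ DualNonneg (f - g) ∧ g x = f x⁺ := by
  obtain ⟨g, hg, hle, hx⟩ := exists_dualNonneg_le_apply_eq (q := f) (C := ‖f‖)
    (fun c _ y => by simp) (fun y z => (map_add f y z).le) (fun y z _ h => hf.monotone h)
    (fun y => (le_abs_self _).trans (f.le_opNorm y)) x
  exact ⟨g, hg, fun y hy => sub_nonneg.2 (hle y hy), hx⟩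

theorem DualNonneg.exists_abs_le_apply_eq_abs {f : StrongDual ℝ E} (hf : DualNonneg f) (x : E) :
    ∃ g : StrongDual ℝ E, (∀ y, |g y| ≤ f |y|) ∧ g x = f |x| := by
  obtain ⟨g, hg, hgf, hx⟩ := hf.exists_le_apply_eq_posPart x
  -- With `0 ≤ g ≤ f` one has `-f ≤ 2g - f ≤ f`, and `g x = f x⁺` makes the value at `x` equal to `2
  -- f x⁺ - f x = f |x|`.
  refine ⟨g + g - f, fun y => ?_, ?_⟩
  · have h1 := hg _ (posPart_nonneg y)
    have h2 := hg _ (negPart_nonneg y)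
    have h3 := hgf _ (posPart_nonneg y)
    have h4 := hgf _ (negPart_nonneg y)
    have hy : (g + g - f) y = (g + g - f) (y⁺ - y⁻) := by rw [posPart_sub_negPart]
    rw [hy, ← posPart_add_negPart y]
    simp only [sub_apply, add_apply, map_add, map_sub] at *
    exact abs_le'.2 ⟨by linarith, by linarith⟩
  · have hy : f x = f (x⁺ - x⁻) := by rw [posPart_sub_negPart]
    rw [← posPart_add_negPart x]
    simp only [sub_apply, add_apply, map_add, map_sub] at *
    linarith

end Functionals

/-! ### Rosenthal's combinatorial lemma -/

section Rosenthal

/-- `Nat.pair` splits the indices into infinitely many infinite rows. If no row works, each row `p`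
has an index `q p` and a finite set `s p` in the same row carrying mass more than `δ`. The
transversal of the points `q p` misses every `s p`, so its row sums are at most `j * δ`, and
induction applies to it. -/
theorem exists_injective_sum_le_of_sum_le {δ : ℝ} (hδ : 0 < δ) (j : ℕ) :
    ∀ m : ℕ → ℕ → ℝ, (∀ n k, 0 ≤ m n k) → (∀ n (s : Finset ℕ), ∑ k ∈ s, m n k ≤ j * δ) →
      ∃ φ : ℕ → ℕ, φ.Injective ∧
        ∀ n (s : Finset ℕ), n ∉ s → ∑ k ∈ s, m (φ n) (φ k) ≤ δ := by
  induction j with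
  | zero =>
    intro m _ hm
    exact ⟨id, Function.injective_id, fun n s _ => (hm n s).trans (by simpa using hδ.le)⟩
  | succ j ih =>
    intro m h0 hm
    by_cases h : ∃ p : ℕ, ∀ q (s : Finset ℕ), q ∉ s →
        ∑ k ∈ s, m (Nat.pair p q) (Nat.pair p k) ≤ δ
    · obtain ⟨p, hp⟩ := h
      exact ⟨Nat.pair p, fun a b hab => (Nat.pair_eq_pair.1 hab).2, hp⟩
    · push Not at h
      choose q s hqs hs using h
      have hinj : Function.Injective fun p => Nat.pair p (q p) :=
        fun a b hab => (Nat.pair_eq_pair.1 hab).1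
      obtain ⟨φ, hφ, hφs⟩ := ih (fun p r => m (Nat.pair p (q p)) (Nat.pair r (q r)))
        (fun _ _ => h0 _ _) (fun p t => by
          have hd : Disjoint (t.map ⟨_, hinj⟩) ((s p).map ⟨Nat.pair p,
              fun a b hab => (Nat.pair_eq_pair.1 hab).2⟩) := by
            rw [Finset.disjoint_left]
            intro a ha hb
            simp only [Finset.mem_map, Function.Embedding.coeFn_mk] at ha hb
            obtain ⟨r, -, rfl⟩ := ha
            obtain ⟨k, hk, hkr⟩ := hb
            obtain ⟨rfl, rfl⟩ := Nat.pair_eq_pair.1 hkr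
            exact hqs _ hk
          have h1 := hm (Nat.pair p (q p)) ((t.map ⟨_, hinj⟩).disjUnion _ hd)
          rw [Finset.sum_disjUnion, Finset.sum_map, Finset.sum_map] at h1
          have h2 := hs p
          change ∑ x ∈ t, m (Nat.pair p (q p)) (Nat.pair x (q x)) +
            ∑ x ∈ s p, m (Nat.pair p (q p)) (Nat.pair p x) ≤ _ at h1
          push_cast at h1
          linarith)
      exact ⟨fun n => Nat.pair (φ n) (q (φ n)), hinj.comp hφ, hφs⟩

end Rosenthal

/-! ### Building a copy of `c₀` -/

section CZero

variable {F : Type*} [NormedAddCommGroup F] [NormedSpace ℝ F] [Lattice F] [IsOrderedAddMonoid F]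
  [IsOrderedModule ℝ F] [HasSolidNorm F]

theorem abs_real_smul_of_nonneg (c : ℝ) {u : F} (hu : 0 ≤ u) : |c • u| ≤ |c| • u :=
  abs_le'.2 ⟨smul_le_smul_of_nonneg_right (le_abs_self c) hu, by
    rw [← neg_smul]; exact smul_le_smul_of_nonneg_right (neg_le_abs c) hu⟩

theorem abs_sum_le_sum_abs' {ι : Type*} (s : Finset ι) (v : ι → F) :
    |∑ i ∈ s, v i| ≤ ∑ i ∈ s, |v i| :=
  Finset.le_sum_of_subadditive _ abs_zero.le (fun a b => abs_add_le a b) s v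

theorem norm_sum_smul_le {u : ℕ → F} (hu : ∀ n, 0 ≤ u n) {M : ℝ}
    (hM : ∀ s : Finset ℕ, ‖∑ k ∈ s, u k‖ ≤ M) (s : Finset ℕ) {a : ℕ → ℝ} {C : ℝ} (hC : 0 ≤ C)
    (ha : ∀ k ∈ s, |a k| ≤ C) : ‖∑ k ∈ s, a k • u k‖ ≤ C * M := by
  have h : |∑ k ∈ s, a k • u k| ≤ |C • ∑ k ∈ s, u k| := by
    refine (abs_sum_le_sum_abs' _ _).trans (le_trans ?_ (le_abs_self _))
    rw [Finset.smul_sum]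
    exact Finset.sum_le_sum fun k hk => (abs_real_smul_of_nonneg _ (hu k)).trans
      (smul_le_smul_of_nonneg_right (ha k hk) (hu k))
  refine (norm_le_norm_of_abs_le_abs h).trans ?_
  rw [norm_smul, Real.norm_of_nonneg hC]
  exact mul_le_mul_of_nonneg_left (hM s) hC

theorem summable_smul_of_zeroAtInfty [CompleteSpace F] {u : ℕ → F} (hu : ∀ n, 0 ≤ u n) {M : ℝ}
    (hM : ∀ s : Finset ℕ, ‖∑ k ∈ s, u k‖ ≤ M) (a : C₀(ℕ, ℝ)) :
    Summable fun k => a k • u k := by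
  have hM0 : 0 ≤ M := (norm_nonneg _).trans (hM ∅)
  rw [summable_iff_vanishing_norm]
  intro ε hε
  have hc := a.zero_at_infty'
  rw [cocompact_eq_cofinite] at hc
  have hδ : 0 < ε / (M + 1) := by positivity
  have hfin : {k : ℕ | ¬ |a k| < ε / (M + 1)}.Finite := by
    have := hc.eventually (Metric.ball_mem_nhds 0 hδ)
    simpa [Filter.eventually_cofinite] using this
  refine ⟨hfin.toFinset, fun t ht => ?_⟩
  refine (norm_sum_smul_le hu hM t hδ.le fun k hk => ?_).trans_lt ?_
  · have := Finset.disjoint_left.1 ht hk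
    simp only [Set.Finite.mem_toFinset, Set.mem_ofPred_eq, not_not] at this
    exact this.le
  · rw [div_mul_eq_mul_div, div_lt_iff₀ (by positivity)]
    nlinarith

theorem ZeroAtInftyContinuousMap.abs_apply_le_norm (a : C₀(ℕ, ℝ)) (k : ℕ) : |a k| ≤ ‖a‖ := by
  have := a.toBCF.norm_coe_le_norm k
  rwa [ZeroAtInftyContinuousMap.norm_toBCF_eq_norm] at this

theorem ZeroAtInftyContinuousMap.norm_le_of_forall_abs_le (a : C₀(ℕ, ℝ)) {C : ℝ}
    (h : ∀ k, |a k| ≤ C) : ‖a‖ ≤ C := by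
  rw [← ZeroAtInftyContinuousMap.norm_toBCF_eq_norm]
  exact (BoundedContinuousFunction.norm_le ((abs_nonneg _).trans (h 0))).2 h

/-- The embedding is `a ↦ ∑ a k • v k` along a subsequence `v` of `u`. Boundedness of finite sums
makes it continuous. Rosenthal's lemma, applied to the norming functionals of the `u n`, keeps the
off-diagonal mass below `ε / 2`, which makes it bounded below. -/
theorem cZeroEmbeds_of_sum_norm_le [CompleteSpace F] {u : ℕ → F} (hu : ∀ n, 0 ≤ u n) {M : ℝ}
    (hM : ∀ s : Finset ℕ, ‖∑ k ∈ s, u k‖ ≤ M) {ε : ℝ} (hε : 0 < ε) (hle : ∀ n, ε ≤ ‖u n‖) :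
    CZeroEmbeds F := by
  choose f hf hfn hfu using fun n => exists_dualNonneg_apply_eq_norm_posPart (u n)
  obtain ⟨j, hj⟩ := exists_nat_ge (M / (ε / 2))
  rw [div_le_iff₀ (by positivity)] at hj
  obtain ⟨φ, hφ, hφs⟩ := exists_injective_sum_le_of_sum_le (half_pos hε) j (fun n k => f n (u k))
    (fun n k => hf n _ (hu k)) (fun n s => by
      rw [← map_sum]
      refine (le_abs_self _).trans (((f n).le_opNorm _).trans (le_trans ?_ hj))
      exact (mul_le_mul (hfn n) (hM s) (norm_nonneg _) zero_le_one).trans (one_mul M).le)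
  set v : ℕ → F := u ∘ φ with hv
  have hv0 : ∀ n, 0 ≤ v n := fun n => hu _
  have hvM : ∀ s : Finset ℕ, ‖∑ k ∈ s, v k‖ ≤ M := fun s => by
    have := hM (s.map ⟨φ, hφ⟩)
    rwa [Finset.sum_map] at this
  have hs := summable_smul_of_zeroAtInfty hv0 hvM
  have hub : ∀ a : C₀(ℕ, ℝ), ‖∑' k, a k • v k‖ ≤ M * ‖a‖ := fun a => by
    refine le_of_tendsto (hs a).hasSum.norm (Eventually.of_forall fun s => ?_)
    rw [mul_comm]
    exact norm_sum_smul_le hv0 hvM s (norm_nonneg a) fun k _ => a.abs_apply_le_norm k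
  let J₀ : C₀(ℕ, ℝ) →ₗ[ℝ] F :=
    { toFun := fun a => ∑' k, a k • v k
      map_add' := fun a b => by
        rw [← (hs a).tsum_add (hs b)]
        exact tsum_congr fun k => by rw [ZeroAtInftyContinuousMap.add_apply, add_smul]
      map_smul' := fun c a => by
        rw [RingHom.id_apply, ← (hs a).tsum_const_smul c]
        exact tsum_congr fun k => by
          rw [ZeroAtInftyContinuousMap.smul_apply, smul_eq_mul, mul_smul] }
  let J : C₀(ℕ, ℝ) →L[ℝ] F := J₀.mkContinuous M hub
  -- The functional norming `v n` sees at least `|a n| * ε` from the diagonal term and at most `‖a‖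
  -- * (ε / 2)` from all the others.
  have hlb : ∀ (a : C₀(ℕ, ℝ)) n, |a n| * ε - ‖a‖ * (ε / 2) ≤ ‖J a‖ := fun a n => by
    have ht : Tendsto (fun s : Finset ℕ => ‖∑ k ∈ s, a k • v k‖) atTop (𝓝 ‖J a‖) :=
      (hs a).hasSum.norm
    refine ge_of_tendsto ht ?_
    filter_upwards [eventually_ge_atTop {n}] with s hns
    have hn : n ∈ s := hns (Finset.mem_singleton_self n)
    have h1 : |f (φ n) (∑ k ∈ s, a k • v k)| ≤ ‖∑ k ∈ s, a k • v k‖ :=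
      ((f (φ n)).le_opNorm _).trans
        ((mul_le_mul_of_nonneg_right (hfn _) (norm_nonneg _)).trans (one_mul _).le)
    refine le_trans ?_ h1
    rw [map_sum, ← Finset.add_sum_erase s _ hn]
    have h2 : |∑ k ∈ s.erase n, f (φ n) (a k • v k)| ≤ ‖a‖ * (ε / 2) := by
      refine (Finset.abs_sum_le_sum_abs _ _).trans ?_
      refine (Finset.sum_le_sum fun k _ => ?_).trans ((Finset.mul_sum (s.erase n)
        (fun k => f (φ n) (v k)) ‖a‖).symm.le.trans (mul_le_mul_of_nonneg_left
          (hφs n _ (Finset.notMem_erase n s)) (norm_nonneg a)))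
      rw [map_smul, smul_eq_mul, abs_mul, abs_of_nonneg (hf _ _ (hv0 k))]
      exact mul_le_mul_of_nonneg_right (a.abs_apply_le_norm k) (hf _ _ (hv0 k))
    have h3 : |a n| * ε ≤ |f (φ n) (a n • v n)| := by
      rw [map_smul, smul_eq_mul, abs_mul]
      refine mul_le_mul_of_nonneg_left ?_ (abs_nonneg _)
      have := hfu (φ n)
      rw [posPart_eq_self.2 (hu _)] at this
      exact (hle _).trans (this.symm.le.trans (le_abs_self _))
    have h4 := abs_sub_abs_le_abs_add (f (φ n) (a n • v n))
      (∑ k ∈ s.erase n, f (φ n) (a k • v k))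
    linarith
  have hanti : ∀ a : C₀(ℕ, ℝ), ‖a‖ ≤ (2 / ε) * ‖J a‖ := fun a => by
    have : ‖a‖ ≤ (‖J a‖ + ‖a‖ * (ε / 2)) / ε := a.norm_le_of_forall_abs_le fun k => by
      rw [le_div_iff₀ hε]
      linarith [hlb a k]
    rw [le_div_iff₀ hε] at this
    rw [div_mul_eq_mul_div, le_div_iff₀ hε]
    linarith
  have hal : AntilipschitzWith (Real.toNNReal (2 / ε)) J :=
    AddMonoidHomClass.antilipschitz_of_bound J fun a => by
      rw [Real.coe_toNNReal _ (by positivity)]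
      exact hanti a
  exact ⟨J, (hal.isUniformEmbedding J.uniformContinuous).isEmbedding⟩

end CZero

/-! ### Monotone convergence in the absence of `c₀` -/

section KB

variable {F : Type*} [NormedAddCommGroup F] [NormedSpace ℝ F] [Lattice F] [IsOrderedAddMonoid F]
  [IsOrderedModule ℝ F] [HasSolidNorm F] [CompleteSpace F]

/-- Failure allows an endless climb inside `D` by steps of norm at least `ε`. The steps are positive
and their finite sums lie below `x N - x 0`, so they yield a copy of `c₀`. -/
theorem exists_forall_norm_sub_lt_of_directedOn (hc : ¬ CZeroEmbeds F) {D : Set F}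
    (hne : D.Nonempty) {M : ℝ} (hM : ∀ x ∈ D, ‖x‖ ≤ M) {ε : ℝ} (hε : 0 < ε) :
    ∃ x ∈ D, ∀ y ∈ D, x ≤ y → ‖y - x‖ < ε := by
  by_contra! h
  choose! g hg hle hgε using h
  obtain ⟨x₀, hx₀⟩ := hne
  let x : ℕ → F := fun n => g^[n] x₀
  have hxs : ∀ n, x (n + 1) = g (x n) := fun n => Function.iterate_succ_apply' g n x₀
  have hxD : ∀ n, x n ∈ D := fun n => by
    induction n with
    | zero => exact hx₀
    | succ n ih => rw [hxs]; exact hg _ ih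
  have hu : ∀ n, 0 ≤ x (n + 1) - x n := fun n => by
    rw [hxs]; exact sub_nonneg.2 (hle _ (hxD n))
  refine hc (cZeroEmbeds_of_sum_norm_le hu (M := M + M) (fun s => ?_) hε
    fun n => by rw [hxs]; exact hgε _ (hxD n))
  obtain ⟨N, hN⟩ := s.exists_nat_subset_range
  have h1 : ∑ k ∈ s, (x (k + 1) - x k) ≤ x N - x 0 := by
    rw [← Finset.sum_range_sub]
    exact Finset.sum_le_sum_of_subset_of_nonneg hN fun k _ _ => hu k
  have h2 : 0 ≤ ∑ k ∈ s, (x (k + 1) - x k) := Finset.sum_nonneg fun k _ => hu k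
  refine (norm_le_norm_of_abs_le_abs ?_).trans ((norm_sub_le (x N) (x 0)).trans
    (add_le_add (hM _ (hxD N)) (hM _ (hxD 0))))
  rwa [abs_of_nonneg h2, abs_of_nonneg (h2.trans h1)]

/-- In a Banach lattice without a copy of `c₀`, a norm bounded upward directed set has a supremum,
and the supremum is a norm limit. -/
theorem exists_mem_upperBounds_closure_of_directedOn (hc : ¬ CZeroEmbeds F) {D : Set F}
    (hne : D.Nonempty) (hD : DirectedOn (· ≤ ·) D) {M : ℝ} (hM : ∀ x ∈ D, ‖x‖ ≤ M) :
    ∃ a ∈ upperBounds D, a ∈ closure D := by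
  choose x hxD hx using fun n : ℕ =>
    exists_forall_norm_sub_lt_of_directedOn hc hne hM (pow_pos (one_half_pos (α := ℝ)) n)
  have hp : Tendsto (fun n : ℕ => (1 / 2 : ℝ) ^ n) atTop (𝓝 0) :=
    tendsto_pow_atTop_nhds_zero_of_lt_one (by norm_num) (by norm_num)
  have hcau : CauchySeq x := by
    refine cauchySeq_of_le_tendsto_0 (fun n => (1 / 2 : ℝ) ^ n + (1 / 2 : ℝ) ^ n) ?_
      (by simpa using hp.add hp)
    intro n m N hn hm
    obtain ⟨z, hz, hnz, hmz⟩ := hD _ (hxD n) _ (hxD m)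
    have h1 := hx n z hz hnz
    have h2 := hx m z hz hmz
    rw [dist_eq_norm, show x n - x m = (z - x m) - (z - x n) by abel]
    have h3 := norm_sub_le (z - x m) (z - x n)
    have h4 := pow_le_pow_of_le_one (by norm_num : (0 : ℝ) ≤ 1 / 2) (by norm_num) hn
    have h5 := pow_le_pow_of_le_one (by norm_num : (0 : ℝ) ≤ 1 / 2) (by norm_num) hm
    linarith
  obtain ⟨a, ha⟩ := cauchySeq_tendsto_of_complete hcau
  refine ⟨a, fun y hy => ?_, mem_closure_of_tendsto ha (Eventually.of_forall hxD)⟩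
  -- A common majorant `z n` of `y` and `x n` is within `2⁻ⁿ` of `x n`, so `z n` also tends to `a`.
  choose z hz hyz hxz using fun n => hD y hy (x n) (hxD n)
  have hza : Tendsto (fun n => (z n - x n) + x n) atTop (𝓝 (0 + a)) :=
    (squeeze_zero_norm (fun n => (hx n (z n) (hz n) (hxz n)).le) hp).add ha
  rw [zero_add] at hza
  refine ge_of_tendsto hza (Eventually.of_forall fun n => ?_)
  simpa using hyz n

theorem exists_mem_lowerBounds_closure_of_directedOn (hc : ¬ CZeroEmbeds F) {D : Set F}
    (hne : D.Nonempty) (hD : DirectedOn (· ≥ ·) D) {M : ℝ} (hM : ∀ x ∈ D, ‖x‖ ≤ M) :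
    ∃ a ∈ lowerBounds D, a ∈ closure D := by
  obtain ⟨a, ha, hac⟩ := exists_mem_upperBounds_closure_of_directedOn hc (D := -D) hne.neg
    (fun x hx y hy => by
      obtain ⟨z, hz, h1, h2⟩ := hD _ hx _ hy
      exact ⟨-z, by simpa using hz, le_neg.2 h1, le_neg.2 h2⟩)
    (M := M) (fun x hx => by simpa using hM _ hx)
  refine ⟨-a, fun x hx => neg_le.2 (ha (by simpa using hx)), ?_⟩
  rw [← neg_closure] at hac
  exact hac

end KB

/-! ### The modulus of an order bounded operator -/

section RieszKantorovich

variable {E F : Type*} [AddCommGroup E] [Lattice E] [IsOrderedAddMonoid E] [Module ℝ E]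
  [IsOrderedModule ℝ E] [AddCommGroup F] [Lattice F] [IsOrderedAddMonoid F] [Module ℝ F]
  [IsOrderedModule ℝ F]

/-- An additive, positively homogeneous map on the positive cone extends to a linear map. -/
theorem exists_linearMap_eq_on_nonneg {r : E → F}
    (hadd : ∀ x y, 0 ≤ x → 0 ≤ y → r (x + y) = r x + r y)
    (hsmul : ∀ (c : ℝ) x, 0 < c → 0 ≤ x → r (c • x) = c • r x) :
    ∃ R : E →ₗ[ℝ] F, ∀ x, 0 ≤ x → R x = r x := by
  have r0 : r 0 = 0 := by
    have := hadd 0 0 le_rfl le_rfl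
    simpa using this
  -- The value `r a - r b` depends only on `a - b`, so `x⁺ - x⁻` may be replaced by any other
  -- positive decomposition.
  have hsub : ∀ a b c d : E, 0 ≤ a → 0 ≤ b → 0 ≤ c → 0 ≤ d → a - b = c - d →
      r a - r b = r c - r d := fun a b c d ha hb hc hd h => by
    have h1 : a + d = c + b := by
      rw [sub_eq_sub_iff_add_eq_add] at h; exact h
    have h2 := congrArg r h1
    rw [hadd a d ha hd, hadd c b hc hb] at h2
    rw [sub_eq_sub_iff_add_eq_add]; exact h2
  have hneg : ∀ x : E, r (-x)⁺ - r (-x)⁻ = -(r x⁺ - r x⁻) := fun x => by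
    rw [posPart_neg, negPart_neg, neg_sub]
  have hpos : ∀ (c : ℝ) (x : E), 0 < c → r (c • x)⁺ - r (c • x)⁻ = c • (r x⁺ - r x⁻) :=
    fun c x hc => by
      rw [smul_sub, ← hsmul c _ hc (posPart_nonneg x), ← hsmul c _ hc (negPart_nonneg x)]
      refine hsub _ _ _ _ (posPart_nonneg _) (negPart_nonneg _)
        (smul_nonneg hc.le (posPart_nonneg x)) (smul_nonneg hc.le (negPart_nonneg x)) ?_
      rw [← smul_sub, posPart_sub_negPart, posPart_sub_negPart]
  refine ⟨{ toFun := fun x => r x⁺ - r x⁻, map_add' := fun x y => ?_, map_smul' := fun c x => ?_ },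
    fun x hx => ?_⟩
  · rw [hsub (x + y)⁺ (x + y)⁻ (x⁺ + y⁺) (x⁻ + y⁻) (posPart_nonneg _) (negPart_nonneg _)
      (add_nonneg (posPart_nonneg _) (posPart_nonneg _))
      (add_nonneg (negPart_nonneg _) (negPart_nonneg _)),
      hadd _ _ (posPart_nonneg _) (posPart_nonneg _),
      hadd _ _ (negPart_nonneg _) (negPart_nonneg _)]
    · abel
    · rw [add_sub_add_comm, posPart_sub_negPart, posPart_sub_negPart, posPart_sub_negPart]
  · rw [RingHom.id_apply]
    rcases lt_trichotomy c 0 with hc | rfl | hc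
    · have := hpos (-c) x (neg_pos.2 hc)
      rw [neg_smul, hneg, neg_smul, neg_inj] at this
      exact this
    · simp
    · exact hpos c x hc
  · simp [posPart_eq_self.2 hx, negPart_eq_zero.2 hx, r0]

/-- Riesz–Kantorovich: an order bounded operator into a Dedekind complete space has a modulus. -/
theorem exists_isOperatorModulus (hF : IsDedekindComplete F) {T : E →ₗ[ℝ] F}
    (hT : IsOrderBoundedOperator T) : ∃ R : E →ₗ[ℝ] F, IsOperatorModulus T R := by
  have hex : ∀ x : E, ∃ a, 0 ≤ x → IsLUB (T '' {y | |y| ≤ x}) a := fun x => by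
    by_cases hx : 0 ≤ x
    · have hb : BddAbove (T '' {y | |y| ≤ x}) := by
        obtain ⟨a, b, hab⟩ := hT {y | |y| ≤ x} ⟨-x, x, fun y hy =>
        ⟨neg_le.1 ((neg_le_abs y).trans hy), (le_abs_self y).trans hy⟩⟩
        exact ⟨b, fun z hz => (hab hz).2⟩
      obtain ⟨a, ha⟩ := hF _ ⟨T 0, Set.mem_image_of_mem T (by simpa using hx)⟩ hb
      exact ⟨a, fun _ => ha⟩
    · exact ⟨0, fun h => absurd h hx⟩
  choose r hr using hex
  have hle : ∀ x y, |y| ≤ x → T y ≤ r x := fun x y h =>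
    (hr x ((abs_nonneg y).trans h)).1 ⟨y, h, rfl⟩
  have hadd : ∀ x y, 0 ≤ x → 0 ≤ y → r (x + y) = r x + r y := fun x y hx hy => by
    refine le_antisymm ((hr _ (add_nonneg hx hy)).2 ?_) ?_
    · rintro _ ⟨z, hz, rfl⟩
      obtain ⟨z₁, z₂, h1, h2, rfl⟩ := exists_abs_le_decomposition hx hy hz
      rw [map_add]
      exact add_le_add (hle _ _ h1) (hle _ _ h2)
    · rw [← le_sub_iff_add_le]
      refine (hr x hx).2 ?_
      rintro _ ⟨z₁, h1, rfl⟩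
      rw [le_sub_comm]
      refine (hr y hy).2 ?_
      rintro _ ⟨z₂, h2, rfl⟩
      rw [le_sub_iff_add_le', ← map_add]
      exact hle _ _ ((abs_add_le z₁ z₂).trans (add_le_add h1 h2))
  have hsle : ∀ (c : ℝ) x, 0 < c → 0 ≤ x → c • r x ≤ r (c • x) := fun c x hc hx => by
    rw [← le_inv_smul_iff_of_pos hc]
    refine (hr x hx).2 ?_
    rintro _ ⟨z, hz, rfl⟩
    rw [le_inv_smul_iff_of_pos hc, ← map_smul]
    refine hle _ _ (abs_le'.2 ⟨?_, ?_⟩)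
    · exact smul_le_smul_of_nonneg_left ((le_abs_self z).trans hz) hc.le
    · rw [← smul_neg]
      exact smul_le_smul_of_nonneg_left ((neg_le_abs z).trans hz) hc.le
  obtain ⟨R, hR⟩ := exists_linearMap_eq_on_nonneg hadd fun c x hc hx => by
    refine le_antisymm ?_ (hsle c x hc hx)
    have := hsle c⁻¹ (c • x) (inv_pos.2 hc) (smul_nonneg hc.le hx)
    rwa [inv_smul_smul₀ hc.ne', inv_smul_le_iff_of_pos hc] at this
  refine ⟨R, fun x hx => ?_, fun x hx => ?_, fun S hS hS' x hx => ?_⟩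
  · rw [LinearMap.sub_apply, hR x hx, sub_nonneg]
    exact hle x x (abs_of_nonneg hx).le
  · rw [LinearMap.sub_apply, hR x hx, sub_nonneg, LinearMap.neg_apply, ← map_neg]
    exact hle x (-x) (by rw [abs_neg]; exact (abs_of_nonneg hx).le)
  · rw [LinearMap.sub_apply, hR x hx, sub_nonneg]
    refine (hr x hx).2 ?_
    have hTS : ∀ z, 0 ≤ z → T z ≤ S z := fun z hz => sub_nonneg.1 (hS z hz)
    have hTS' : ∀ z, 0 ≤ z → -T z ≤ S z := fun z hz => sub_nonneg.1 (hS' z hz)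
    have hS0 : ∀ z, 0 ≤ z → 0 ≤ S z := fun z hz => by
      have h2 : (0 : F) ≤ (2 : ℝ) • S z := by
        rw [two_smul, ← add_neg_cancel (T z)]
        exact add_le_add (hTS z hz) (hTS' z hz)
      have := smul_nonneg (by norm_num : (0 : ℝ) ≤ 1 / 2) h2
      rwa [smul_smul, show (1 / 2 : ℝ) * 2 = 1 by norm_num, one_smul] at this
    rintro _ ⟨z, hz, rfl⟩
    calc T z = T z⁺ + -T z⁻ := by
          rw [← sub_eq_add_neg, ← map_sub, posPart_sub_negPart]
      _ ≤ S z⁺ + S z⁻ := add_le_add (hTS _ (posPart_nonneg z)) (hTS' _ (negPart_nonneg z))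
      _ = S |z| := by rw [← map_add, posPart_add_negPart]
      _ ≤ S x := nonneg_linearMap_monotone hS0 hz

theorem IsOperatorModulus.apply_nonneg {T R : E →ₗ[ℝ] F} (h : IsOperatorModulus T R) {x : E}
    (hx : 0 ≤ x) : 0 ≤ R x := by
  have h1 : T x ≤ R x := sub_nonneg.1 (h.le x hx)
  have h3 : -T x ≤ R x := sub_nonneg.1 (h.neg_le x hx)
  have h2 : (0 : F) ≤ (2 : ℝ) • R x := by
    rw [two_smul, ← add_neg_cancel (T x)]
    exact add_le_add h1 h3
  have := smul_nonneg (by norm_num : (0 : ℝ) ≤ 1 / 2) h2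
  rwa [smul_smul, show (1 / 2 : ℝ) * 2 = 1 by norm_num, one_smul] at this

end RieszKantorovich

/-! ### Automatic continuity of positive operators -/

section Continuity

variable {E F : Type*} [NormedAddCommGroup E] [NormedSpace ℝ E] [Lattice E] [IsOrderedAddMonoid E]
  [IsOrderedModule ℝ E] [HasSolidNorm E] [CompleteSpace E]
  [NormedAddCommGroup F] [NormedSpace ℝ F] [Lattice F] [IsOrderedAddMonoid F]
  [IsOrderedModule ℝ F] [HasSolidNorm F]

/-- A positive operator on a Banach lattice is bounded. -/
theorem exists_bound_of_nonneg {S : E →ₗ[ℝ] F} (hS : ∀ x, 0 ≤ x → 0 ≤ S x) :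
    ∃ C, 0 ≤ C ∧ ∀ x, ‖S x‖ ≤ C * ‖x‖ := by
  by_contra! h
  have hm := nonneg_linearMap_monotone hS
  choose x hx using fun n : ℕ => h ((n : ℝ) * 2 ^ n) (by positivity)
  have hx0 : ∀ n, 0 < ‖x n‖ := fun n => by
    refine (norm_nonneg _).lt_of_ne' fun h0 => ?_
    have := hx n
    rw [norm_eq_zero.1 h0] at this
    simp at this
  -- The `y n` have summable norms, so their sum dominates each of them, while `‖S (y n)‖ > n` by
  -- the choice of `x n`.
  let y : ℕ → E := fun n => ((1 / 2 : ℝ) ^ n * ‖x n‖⁻¹) • |x n|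
  have hy0 : ∀ n, 0 ≤ y n := fun n => smul_nonneg (by positivity) (abs_nonneg _)
  have hyn : ∀ n, ‖y n‖ = (1 / 2 : ℝ) ^ n := fun n => by
    rw [norm_smul, norm_abs_eq_norm, Real.norm_of_nonneg (by positivity), mul_assoc,
      inv_mul_cancel₀ (hx0 n).ne', mul_one]
  have hsum : Summable y := by
    refine Summable.of_norm ?_
    simp only [hyn]
    exact summable_geometric_of_lt_one (by norm_num) (by norm_num)
  obtain ⟨n, hn⟩ := exists_nat_ge ‖S (∑' k, y k)‖
  have h1 : S (y n) ≤ S (∑' k, y k) := hm (hsum.le_tsum n fun k _ => hy0 k)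
  have h2 : ‖S (y n)‖ ≤ ‖S (∑' k, y k)‖ := norm_le_norm_of_abs_le_abs (by
    rwa [abs_of_nonneg (hS _ (hy0 n)), abs_of_nonneg ((hS _ (hy0 n)).trans h1)])
  have h3 : ‖S (x n)‖ ≤ ‖S |x n|‖ := norm_le_norm_of_abs_le_abs (by
    rw [abs_of_nonneg (hS _ (abs_nonneg _))]
    exact abs_le'.2 ⟨hm (le_abs_self _), by rw [← map_neg]; exact hm (neg_le_abs _)⟩)
  have h4 : ‖S (y n)‖ = (1 / 2 : ℝ) ^ n * ‖x n‖⁻¹ * ‖S |x n|‖ := by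
    rw [map_smul, norm_smul, Real.norm_of_nonneg (by positivity)]
  have h5 : (n : ℝ) < ‖S (y n)‖ := by
    calc (n : ℝ) = (1 / 2 : ℝ) ^ n * ‖x n‖⁻¹ * (n * 2 ^ n * ‖x n‖) := by
          have := (hx0 n).ne'
          field_simp
          rw [mul_assoc, ← mul_pow]; norm_num
      _ < (1 / 2 : ℝ) ^ n * ‖x n‖⁻¹ * ‖S |x n|‖ := by
          have := hx0 n
          exact mul_lt_mul_of_pos_left ((hx n).trans_le h3) (by positivity)
      _ = _ := h4.symm
  linarith

theorem isDedekindComplete_real : IsDedekindComplete ℝ :=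
  fun _ hne hb => ⟨_, Real.isLUB_sSup hne hb⟩

theorem StrongDual.exists_dualNonneg_abs_le (g : StrongDual ℝ E) :
    ∃ f : StrongDual ℝ E, DualNonneg f ∧ ∀ y, |g y| ≤ f |y| := by
  have hg : IsOrderBoundedOperator g.toLinearMap := by
    rintro A ⟨a, b, hA⟩
    refine ⟨g a - ‖g‖ * ‖b - a‖, g a + ‖g‖ * ‖b - a‖, ?_⟩
    rintro _ ⟨x, hx, rfl⟩
    have h1 : 0 ≤ x - a := sub_nonneg.2 (hA hx).1
    have h2 : x - a ≤ b - a := sub_le_sub_right (hA hx).2 a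
    have h3 : ‖x - a‖ ≤ ‖b - a‖ := norm_le_norm_of_abs_le_abs (by
      rwa [abs_of_nonneg h1, abs_of_nonneg (h1.trans h2)])
    have h4 : |g (x - a)| ≤ ‖g‖ * ‖b - a‖ :=
      (g.le_opNorm _).trans (mul_le_mul_of_nonneg_left h3 (norm_nonneg g))
    rw [map_sub, abs_le] at h4
    change g x ∈ _
    constructor <;> linarith
  obtain ⟨R, hR⟩ := exists_isOperatorModulus isDedekindComplete_real hg
  obtain ⟨C, -, hC⟩ := exists_bound_of_nonneg fun x hx => hR.apply_nonneg hx
  refine ⟨R.mkContinuous C hC, fun x hx => hR.apply_nonneg hx, fun y => ?_⟩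
  have h1 : ∀ z, 0 ≤ z → g z ≤ R z := fun z hz => sub_nonneg.1 (hR.le z hz)
  have h2 : ∀ z, 0 ≤ z → -g z ≤ R z := fun z hz => sub_nonneg.1 (hR.neg_le z hz)
  have h3 : g y = g y⁺ - g y⁻ := by rw [← map_sub, posPart_sub_negPart]
  have h4 : R |y| = R y⁺ + R y⁻ := by rw [← map_add, posPart_add_negPart]
  have := h1 _ (posPart_nonneg y)
  have := h1 _ (negPart_nonneg y)
  have := h2 _ (posPart_nonneg y)
  have := h2 _ (negPart_nonneg y)
  change |g y| ≤ R |y|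
  rw [h3, h4]
  exact abs_le'.2 ⟨by linarith, by linarith⟩

end Continuity

/-! ### Order intervals of the bidual -/

section BOrderInterval

open NormedSpace

variable {E : Type*} [NormedAddCommGroup E] [NormedSpace ℝ E] [Lattice E] [IsOrderedAddMonoid E]
  [IsOrderedModule ℝ E] [HasSolidNorm E]

/-- Splitting `f` as `g + (f - g)` with `g (x - y) = f (x - y)⁺` gives `f (x ⊔ y) = g x + (f - g)
y`, and each part is bounded by `ψ`. -/
theorem BidualLE.sup {ψ : StrongDual ℝ (StrongDual ℝ E)} {x y : E}
    (hx : BidualLE (inclusionInDoubleDual ℝ E x) ψ)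
    (hy : BidualLE (inclusionInDoubleDual ℝ E y) ψ) :
    BidualLE (inclusionInDoubleDual ℝ E (x ⊔ y)) ψ := fun f hf => by
  obtain ⟨g, hg, hfg, hgx⟩ := hf.exists_le_apply_eq_posPart (x - y)
  have h1 := hx g hg
  have h2 := hy (f - g) hfg
  rw [dual_def] at *
  rw [sup_eq_add_posPart_sub, map_add, ← hgx]
  simp only [map_sub, sub_apply] at *
  linarith

theorem BidualLE.inf {φ : StrongDual ℝ (StrongDual ℝ E)} {x y : E}
    (hx : BidualLE φ (inclusionInDoubleDual ℝ E x))
    (hy : BidualLE φ (inclusionInDoubleDual ℝ E y)) :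
    BidualLE φ (inclusionInDoubleDual ℝ E (x ⊓ y)) := fun f hf => by
  obtain ⟨g, hg, hfg, hgx⟩ := hf.exists_le_apply_eq_posPart (x - y)
  have h1 := hy g hg
  have h2 := hx (f - g) hfg
  rw [dual_def] at *
  rw [inf_eq_sub_posPart_sub, map_sub, ← hgx]
  simp only [map_sub, sub_apply] at *
  linarith

theorem BidualLE.norm_le {φ ψ : StrongDual ℝ (StrongDual ℝ E)} {x : E}
    (hx : BidualLE φ (inclusionInDoubleDual ℝ E x))
    (hx' : BidualLE (inclusionInDoubleDual ℝ E x) ψ) : ‖x‖ ≤ ‖ψ‖ + ‖φ‖ := by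
  have hop : ∀ (θ : StrongDual ℝ (StrongDual ℝ E)) (g : StrongDual ℝ E), ‖g‖ ≤ 1 →
      |θ g| ≤ ‖θ‖ := fun θ g hg => (θ.le_opNorm g).trans
        ((mul_le_mul_of_nonneg_left hg (norm_nonneg θ)).trans (mul_one _).le)
  have h1 : ‖x⁺‖ ≤ ‖ψ‖ := by
    obtain ⟨g, hg, hgn, hgx⟩ := exists_dualNonneg_apply_eq_norm_posPart x
    have := hx' g hg
    rw [dual_def] at this
    linarith [(abs_le.1 (hop ψ g hgn)).2]
  have h2 : ‖x⁻‖ ≤ ‖φ‖ := by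
    obtain ⟨g, hg, hgn, hgx⟩ := exists_dualNonneg_apply_eq_norm_posPart (-x)
    have := hx g hg
    rw [dual_def] at this
    rw [posPart_neg, map_neg] at hgx
    linarith [(abs_le.1 (hop φ g hgn)).1]
  calc ‖x‖ = ‖x⁺ - x⁻‖ := by rw [posPart_sub_negPart]
    _ ≤ ‖x⁺‖ + ‖x⁻‖ := norm_sub_le _ _
    _ ≤ _ := add_le_add h1 h2

variable {F : Type*} [CompleteSpace E] [NormedAddCommGroup F] [NormedSpace ℝ F] [Lattice F]
  [IsOrderedAddMonoid F] [IsOrderedModule ℝ F] [HasSolidNorm F] [CompleteSpace F]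

theorem isOrderBoundedSet_image_of_isBOrderBounded (hc : ¬ CZeroEmbeds F) {S : E →ₗ[ℝ] F}
    (hS : ∀ x, 0 ≤ x → 0 ≤ S x) {A : Set E} (hA : IsBOrderBounded A) :
    IsOrderBoundedSet (S '' A) := by
  obtain ⟨φ, ψ, h⟩ := hA
  rcases A.eq_empty_or_nonempty with rfl | ⟨x₀, hx₀⟩
  · exact ⟨0, 0, by simp⟩
  -- The set `A` need not be directed, so it is enlarged to the full trace of the interval on `E`,
  -- which is a sublattice.
  let D : Set E := {x | BidualLE φ (inclusionInDoubleDual ℝ E x) ∧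
    BidualLE (inclusionInDoubleDual ℝ E x) ψ}
  have hAD : A ⊆ D := h
  have hmono := nonneg_linearMap_monotone hS
  obtain ⟨C, hC0, hC⟩ := exists_bound_of_nonneg hS
  have hle : ∀ {x y : E}, x ≤ y →
      BidualLE (inclusionInDoubleDual ℝ E x) (inclusionInDoubleDual ℝ E y) :=
    fun hxy f hf => by rw [dual_def, dual_def]; exact hf.monotone hxy
  have hM : ∀ z ∈ S '' D, ‖z‖ ≤ C * (‖ψ‖ + ‖φ‖) := by
    rintro _ ⟨x, hx, rfl⟩
    exact (hC x).trans (mul_le_mul_of_nonneg_left (hx.1.norm_le hx.2) hC0)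
  have hne : (S '' D).Nonempty := ⟨S x₀, x₀, hAD hx₀, rfl⟩
  obtain ⟨b, hb, -⟩ := exists_mem_upperBounds_closure_of_directedOn hc hne (by
    rintro _ ⟨x, hx, rfl⟩ _ ⟨y, hy, rfl⟩
    exact ⟨S (x ⊔ y), ⟨x ⊔ y, ⟨fun f hf => (hx.1 f hf).trans (hle le_sup_left f hf),
      hx.2.sup hy.2⟩, rfl⟩, hmono le_sup_left, hmono le_sup_right⟩) hM
  obtain ⟨a, ha, -⟩ := exists_mem_lowerBounds_closure_of_directedOn hc hne (by
    rintro _ ⟨x, hx, rfl⟩ _ ⟨y, hy, rfl⟩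
    exact ⟨S (x ⊓ y), ⟨x ⊓ y, ⟨hx.1.inf hy.1,
      fun f hf => (hle inf_le_left f hf).trans (hx.2 f hf)⟩, rfl⟩,
      hmono inf_le_left, hmono inf_le_right⟩) hM
  refine ⟨a, b, ?_⟩
  rintro _ ⟨x, hx, rfl⟩
  exact ⟨ha ⟨x, hAD hx, rfl⟩, hb ⟨x, hAD hx, rfl⟩⟩

end BOrderInterval

theorem abs_sub_le_add_abs_sub {G : Type*} [AddCommGroup G] [Lattice G] [IsOrderedAddMonoid G]
    (x y z : G) : |x - z| ≤ |x - y| + |y - z| := by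
  have := abs_add_le (x - y) (y - z)
  rwa [sub_add_sub_cancel] at this

/-! ### An order-valued square -/

section Quadratic

variable {F : Type*} [AddCommGroup F] [Lattice F] [IsOrderedAddMonoid F] [Module ℝ F]
  [IsOrderedModule ℝ F]

/-- An order-valued quadratic form on `[0, u]`, morally `z ↦ z² / u`, with its uniform
convexity. -/
theorem exists_uniformly_convex_map (hF : IsDedekindComplete F) (u : F) :
    ∃ Q : F → F, (∀ z ∈ Set.Icc 0 u, 0 ≤ Q z ∧ Q z ≤ u) ∧
      ∀ x ∈ Set.Icc 0 u, ∀ y ∈ Set.Icc 0 u, ∀ e : ℝ, 0 ≤ e →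
        (2 : ℝ) • Q ((1 / 2 : ℝ) • (x + y)) + (2 * e) • |x - y| ≤ Q x + Q y + (2 * e ^ 2) • u := by
  have hbd : ∀ z ∈ Set.Icc 0 u, ∀ t : ℝ, (2 * t) • z - t ^ 2 • u ≤ u := fun z hz t => by
    have h1 : (2 * t) • z ≤ (1 + t ^ 2) • u :=
      (smul_le_smul_of_nonneg_right (by nlinarith [sq_nonneg (t - 1)]) hz.1).trans
        (smul_le_smul_of_nonneg_left hz.2 (by positivity))
    exact le_of_sub_eq_sub h1 (by module)
  have hex : ∀ z, ∃ a, z ∈ Set.Icc 0 u →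
      IsLUB (Set.range fun t : ℝ => (2 * t) • z - t ^ 2 • u) a := fun z => by
    by_cases hz : z ∈ Set.Icc 0 u
    · obtain ⟨a, ha⟩ := hF (Set.range fun t : ℝ => (2 * t) • z - t ^ 2 • u) (Set.range_nonempty _)
        ⟨u, by rintro _ ⟨t, rfl⟩; exact hbd z hz t⟩
      exact ⟨a, fun _ => ha⟩
    · exact ⟨0, fun h => absurd h hz⟩
  choose Q hQ using hex
  have hle : ∀ z ∈ Set.Icc 0 u, ∀ t : ℝ, (2 * t) • z - t ^ 2 • u ≤ Q z :=
    fun z hz t => (hQ z hz).1 ⟨t, rfl⟩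
  refine ⟨Q, fun z hz => ⟨?_, (hQ z hz).2 ?_⟩, fun x hx y hy e he => ?_⟩
  · simpa using hle z hz 0
  · rintro _ ⟨t, rfl⟩
    exact hbd z hz t
  · have hm : (1 / 2 : ℝ) • (x + y) ∈ Set.Icc 0 u := by
      refine ⟨smul_nonneg (by norm_num) (add_nonneg hx.1 hy.1), ?_⟩
      have := smul_le_smul_of_nonneg_left (add_le_add hx.2 hy.2) (by norm_num : (0 : ℝ) ≤ 1 / 2)
      exact le_of_sub_eq_sub this (by module)
    have key : Q ((1 / 2 : ℝ) • (x + y)) ≤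
        (1 / 2 : ℝ) • (Q x + Q y + (2 * e ^ 2) • u - (2 * e) • |x - y|) := by
      refine (hQ _ hm).2 ?_
      rintro _ ⟨t, rfl⟩
      -- Shifting the parameter by `e` in opposite directions at `x` and `y` produces the terms `±
      -- (2 * e) • (x - y)`, at a cost of `(2 * e ^ 2) • u`.
      have h1 := add_le_add (hle x hx (t + e)) (hle y hy (t - e))
      have h2 := add_le_add (hle x hx (t - e)) (hle y hy (t + e))
      set Z : F := Q x + Q y + (2 * e ^ 2) • u - (2 * t) • (x + y) + (2 * t ^ 2) • u with hZ
      have h3 : |(2 * e) • (x - y)| ≤ Z :=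
        abs_le'.2 ⟨le_of_sub_eq_sub h1 (by rw [hZ]; module),
          le_of_sub_eq_sub h2 (by rw [hZ]; module)⟩
      have h4 : (2 * e) • |x - y| ≤ Z := by
        refine le_trans ?_ h3
        rcases he.eq_or_lt with rfl | he
        · simp
        · rw [← le_inv_smul_iff_of_pos (by positivity)]
          refine abs_le'.2 ⟨?_, ?_⟩ <;> rw [le_inv_smul_iff_of_pos (by positivity)]
          · exact le_abs_self _
          · rw [smul_neg]; exact neg_le_abs _
      have h5 := smul_le_smul_of_nonneg_left h4 (by norm_num : (0 : ℝ) ≤ 1 / 2)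
      exact le_of_sub_eq_sub h5 (by rw [hZ]; module)
    have := smul_le_smul_of_nonneg_left key (by norm_num : (0 : ℝ) ≤ 2)
    exact le_of_sub_eq_sub this (by module)

end Quadratic

/-! ### Completeness and convexity for the seminorm `f |·|` -/

section OrderInterval

variable {F : Type*} [NormedAddCommGroup F] [NormedSpace ℝ F] [Lattice F] [IsOrderedAddMonoid F]
  [IsOrderedModule ℝ F] [HasSolidNorm F]

theorem norm_le_norm_of_nonneg_of_le {x y : F} (hx : 0 ≤ x) (h : x ≤ y) : ‖x‖ ≤ ‖y‖ :=
  norm_le_norm_of_abs_le_abs (by rwa [abs_of_nonneg hx, abs_of_nonneg (hx.trans h)])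

variable [CompleteSpace F]

theorem exists_tendsto_of_monotone (hc : ¬ CZeroEmbeds F) {s : ℕ → F} (hs : Monotone s) {M : ℝ}
    (hM : ∀ n, ‖s n‖ ≤ M) : ∃ a, Tendsto s atTop (𝓝 a) := by
  obtain ⟨a, ha, hac⟩ := exists_mem_upperBounds_closure_of_directedOn hc (Set.range_nonempty s)
    hs.directed_le.directedOn_range (by rintro _ ⟨n, rfl⟩; exact hM n)
  refine ⟨a, Metric.tendsto_atTop.2 fun ε hε => ?_⟩
  obtain ⟨_, ⟨N, rfl⟩, hN⟩ := Metric.mem_closure_iff.1 hac ε hε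
  refine ⟨N, fun n hn => ?_⟩
  rw [dist_comm, dist_eq_norm]
  rw [dist_eq_norm] at hN
  exact (norm_le_norm_of_nonneg_of_le (sub_nonneg.2 (ha ⟨n, rfl⟩))
    (sub_le_sub_left (hs hn) a)).trans_lt hN

theorem exists_tendsto_of_antitone (hc : ¬ CZeroEmbeds F) {s : ℕ → F} (hs : Antitone s) {M : ℝ}
    (hM : ∀ n, ‖s n‖ ≤ M) : ∃ a, Tendsto s atTop (𝓝 a) := by
  obtain ⟨a, ha⟩ := exists_tendsto_of_monotone hc (s := fun n => -s n)
    (fun m n h => neg_le_neg (hs h)) (M := M) (fun n => by simpa using hM n)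
  exact ⟨-a, by simpa using ha.neg⟩

/-- Order intervals are complete for the seminorm `f |·|` of a positive functional `f`. -/
theorem DualNonneg.exists_tendsto_abs_sub {f : StrongDual ℝ F} (hf : DualNonneg f)
    (hc : ¬ CZeroEmbeds F) {u : F} {x : ℕ → F} (hx : ∀ n, x n ∈ Set.Icc 0 u)
    (hd : ∀ n, f |x (n + 1) - x n| ≤ (1 / 2 : ℝ) ^ n) :
    ∃ a ∈ Set.Icc 0 u, Tendsto (fun n => f |a - x n|) atTop (𝓝 0) := by
  have hIcc : ∀ z ∈ Set.Icc 0 u, ‖z‖ ≤ ‖u‖ := fun z hz => norm_le_norm_of_nonneg_of_le hz.1 hz.2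
  -- The limit of `s n` is the supremum `y n` of the tail from `n`. These suprema decrease to `a`,
  -- as for almost everywhere convergence of a fast Cauchy sequence.
  let s : ℕ → ℕ → F := fun n m => partialSups (fun k => x (n + k)) m
  have hxs : ∀ n k m, k ≤ m → x (n + k) ≤ s n m := fun n k m h =>
    le_partialSups_of_le (fun k => x (n + k)) h
  have hsle : ∀ n m z, (∀ k ≤ m, x (n + k) ≤ z) → s n m ≤ z := fun n m z h =>
    partialSups_le (fun k => x (n + k)) m z h
  have hsI : ∀ n m, s n m ∈ Set.Icc 0 u := fun n m =>
    ⟨(hx _).1.trans (hxs n 0 m (Nat.zero_le m)), hsle n m u fun k _ => (hx _).2⟩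
  have hsm : ∀ n, Monotone (s n) := fun n => (partialSups fun k => x (n + k)).monotone
  choose y hy using fun n => exists_tendsto_of_monotone hc (hsm n) fun m => hIcc _ (hsI n m)
  have hyI : ∀ n, y n ∈ Set.Icc 0 u := fun n =>
    isClosed_Icc.mem_of_tendsto (hy n) (Eventually.of_forall (hsI n))
  have hsy : ∀ n m, s n m ≤ y n := fun n m => (hsm n).ge_of_tendsto (hy n) m
  have hxy : ∀ n, x n ≤ y n := fun n => (hxs n 0 0 le_rfl).trans (hsy n 0)
  have hya : Antitone y := antitone_nat_of_succ_le fun n =>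
    le_of_tendsto (hy (n + 1)) (Eventually.of_forall fun m => hsle _ _ _ fun k hk => by
      rw [add_assoc, add_comm 1 k]
      exact (hxs n (k + 1) (k + 1) le_rfl).trans (hsy _ _))
  have hfy : ∀ n, f (y n - x n) ≤ 2 * (1 / 2 : ℝ) ^ n := fun n => by
    have ht : Tendsto (fun m => f (s n m - x n)) atTop (𝓝 (f (y n - x n))) :=
      (f.continuous.tendsto _).comp ((hy n).sub_const (x n))
    refine le_of_tendsto ht (Eventually.of_forall fun m => ?_)
    have h1 : s n m - x n ≤ ∑ i ∈ Finset.range m, |x (n + i + 1) - x (n + i)| := by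
      rw [sub_le_iff_le_add]
      refine hsle n m _ fun k hk => ?_
      rw [← sub_le_iff_le_add]
      calc x (n + k) - x n = ∑ i ∈ Finset.range k, (x (n + i + 1) - x (n + i)) :=
            (Finset.sum_range_sub (fun i => x (n + i)) k).symm
        _ ≤ ∑ i ∈ Finset.range k, |x (n + i + 1) - x (n + i)| :=
            Finset.sum_le_sum fun i _ => le_abs_self _
        _ ≤ _ := Finset.sum_le_sum_of_subset_of_nonneg (Finset.range_mono hk)
            fun i _ _ => abs_nonneg _
    calc f (s n m - x n) ≤ f (∑ i ∈ Finset.range m, |x (n + i + 1) - x (n + i)|) :=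
          hf.monotone h1
      _ ≤ ∑ i ∈ Finset.range m, (1 / 2 : ℝ) ^ (n + i) := by
          rw [map_sum]; exact Finset.sum_le_sum fun i _ => hd (n + i)
      _ = (1 / 2 : ℝ) ^ n * ∑ i ∈ Finset.range m, (1 / 2 : ℝ) ^ i := by
          rw [Finset.mul_sum]; exact Finset.sum_congr rfl fun i _ => pow_add _ _ _
      _ ≤ (1 / 2 : ℝ) ^ n * 2 :=
          mul_le_mul_of_nonneg_left (sum_geometric_two_le m) (by positivity)
      _ = _ := mul_comm _ _
  obtain ⟨a, ha⟩ := exists_tendsto_of_antitone hc hya fun n => hIcc _ (hyI n)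
  refine ⟨a, isClosed_Icc.mem_of_tendsto ha (Eventually.of_forall hyI), ?_⟩
  have hay : ∀ n, a ≤ y n := fun n => hya.le_of_tendsto ha n
  have h1 : Tendsto (fun n => f (y n - a)) atTop (𝓝 0) := by
    have := (f.continuous.tendsto _).comp (ha.sub_const a)
    rwa [sub_self, map_zero] at this
  have h2 : Tendsto (fun n : ℕ => 2 * (1 / 2 : ℝ) ^ n) atTop (𝓝 0) := by
    simpa using (tendsto_pow_atTop_nhds_zero_of_lt_one (by norm_num : (0 : ℝ) ≤ 1 / 2)
      (by norm_num)).const_mul 2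
  have h12 := h1.add h2
  rw [add_zero] at h12
  refine squeeze_zero (fun n => hf _ (abs_nonneg _)) (fun n => ?_) h12
  have h3 : |a - x n| ≤ (y n - a) + (y n - x n) := by
    have e1 := hay n
    have e2 := hxy n
    refine abs_le'.2 ⟨?_, ?_⟩
    · exact le_of_sub_eq_sub (add_le_add e1 e1) (by abel)
    · exact le_of_sub_eq_sub (add_le_add e2 e2) (by abel)
  have h4 := hf.monotone h3
  rw [map_add] at h4
  exact h4.trans (add_le_add le_rfl (hfy n))

/-- A downward directed family of nonempty convex subsets of `[0, u]` clusters at some point for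
the seminorm `f |·|`. -/
theorem DualNonneg.exists_cluster_of_convex {f : StrongDual ℝ F} (hf : DualNonneg f)
    (hF : IsDedekindComplete F) (hc : ¬ CZeroEmbeds F) {u : F} (hu : 0 ≤ u) {𝒲 : Set (Set F)}
    (hne : 𝒲.Nonempty) (hWne : ∀ W ∈ 𝒲, W.Nonempty) (hWu : ∀ W ∈ 𝒲, W ⊆ Set.Icc 0 u)
    (hWc : ∀ W ∈ 𝒲, Convex ℝ W) (hinter : ∀ W ∈ 𝒲, ∀ W' ∈ 𝒲, W ∩ W' ∈ 𝒲) :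
    ∃ a ∈ Set.Icc 0 u, ∀ W ∈ 𝒲, ∀ ε > 0, ∃ z ∈ W, f |z - a| ≤ ε := by
  obtain ⟨Q, hQ, hQc⟩ := exists_uniformly_convex_map hF u
  let q : F → ℝ := fun z => f (Q z)
  let m : Set F → ℝ := fun W => sInf (q '' W)
  have hq0 : ∀ W ∈ 𝒲, ∀ z ∈ W, 0 ≤ q z := fun W hW z hz => hf _ (hQ z (hWu W hW hz)).1
  have hqu : ∀ W ∈ 𝒲, ∀ z ∈ W, q z ≤ f u := fun W hW z hz => hf.monotone (hQ z (hWu W hW hz)).2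
  have hbd : ∀ W ∈ 𝒲, BddBelow (q '' W) := fun W hW => ⟨0, by
    rintro _ ⟨z, hz, rfl⟩; exact hq0 W hW z hz⟩
  have hm : ∀ W ∈ 𝒲, ∀ z ∈ W, m W ≤ q z := fun W hW z hz => csInf_le (hbd W hW) ⟨z, hz, rfl⟩
  have hmb : BddAbove (m '' 𝒲) := ⟨f u, by
    rintro _ ⟨W, hW, rfl⟩
    obtain ⟨z, hz⟩ := hWne W hW
    exact (hm W hW z hz).trans (hqu W hW z hz)⟩
  set s := sSup (m '' 𝒲) with hs
  have hnear : ∀ W ∈ 𝒲, ∀ η > 0, ∃ z ∈ W, q z < s + η := fun W hW η hη => by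
    have h1 : m W < s + η := (le_csSup hmb ⟨W, hW, rfl⟩).trans_lt (lt_add_of_pos_right s hη)
    obtain ⟨_, ⟨z, hz, rfl⟩, hlt⟩ := exists_lt_of_csInf_lt ((hWne W hW).image q) h1
    exact ⟨z, hz, hlt⟩
  have hlow : ∀ η > 0, ∃ W ∈ 𝒲, ∀ z ∈ W, s - η < q z := fun η hη => by
    obtain ⟨_, ⟨W, hW, rfl⟩, hlt⟩ := exists_lt_of_lt_csSup (hne.image m) (sub_lt_self s hη)
    exact ⟨W, hW, fun z hz => hlt.trans_le (hm W hW z hz)⟩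
  have hfu := hf u hu
  set c : ℝ := 2 + f u with hcdef
  have hc0 : 0 < c := by linarith
  -- If `q z` and `q x` are below `s + e ^ 2` while `q` at the midpoint exceeds `s - e ^ 2`, uniform
  -- convexity gives `2 * e * f |z - x| ≤ (4 + 2 * f u) * e ^ 2`, whence `c = 2 + f u`.
  have hball : ∀ e > 0, ∃ W ∈ 𝒲, ∃ x ∈ W, ∀ z ∈ W, q z < s + e ^ 2 → f |z - x| ≤ c * e := by
    intro e he
    obtain ⟨W, hW, hWs⟩ := hlow (e ^ 2) (by positivity)
    obtain ⟨x, hx, hxs⟩ := hnear W hW (e ^ 2) (by positivity)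
    refine ⟨W, hW, x, hx, fun z hz hzs => ?_⟩
    have h1 := hf.monotone (hQc z (hWu W hW hz) x (hWu W hW hx) e he.le)
    have h2 := hWs ((1 / 2 : ℝ) • (z + x)) (by
      rw [smul_add]
      exact hWc W hW hz hx (by norm_num) (by norm_num) (by norm_num))
    simp only [map_add, map_smul, smul_eq_mul] at h1
    change s - e ^ 2 < f (Q _) at h2
    change f (Q z) < _ at hzs
    change f (Q x) < _ at hxs
    have h3 : e * f |z - x| ≤ e * (c * e) := by
      rw [hcdef]; nlinarith
    exact le_of_mul_le_mul_left h3 he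
  let e : ℕ → ℝ := fun n => (1 / 2 : ℝ) ^ n / (2 * c)
  have he : ∀ n, 0 < e n := fun n => by positivity
  have hce : ∀ n, c * e n = (1 / 2 : ℝ) ^ n / 2 := fun n => by
    simp only [e]; field_simp
  choose W hW x hxW hxb using fun n => hball (e n) (he n)
  have hcau : ∀ n, f |x (n + 1) - x n| ≤ (1 / 2 : ℝ) ^ n := fun n => by
    obtain ⟨z, ⟨hz1, hz2⟩, hzq⟩ := hnear _ (hinter _ (hW n) _ (hW (n + 1)))
      (min (e n ^ 2) (e (n + 1) ^ 2)) (lt_min (pow_pos (he _) 2) (pow_pos (he _) 2))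
    have h1 := hxb n z hz1 (hzq.trans_le (add_le_add le_rfl (min_le_left _ _)))
    have h2 := hxb (n + 1) z hz2 (hzq.trans_le (add_le_add le_rfl (min_le_right _ _)))
    have h3 : |x (n + 1) - x n| ≤ |z - x n| + |z - x (n + 1)| := by
      rw [abs_sub_comm z (x (n + 1)), add_comm |z - x n|]
      exact abs_sub_le_add_abs_sub _ _ _
    have h4 := hf.monotone h3
    rw [map_add] at h4
    rw [hce] at h1 h2
    have h5 : (1 / 2 : ℝ) ^ (n + 1) ≤ (1 / 2 : ℝ) ^ n :=
      pow_le_pow_of_le_one (by norm_num) (by norm_num) n.le_succ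
    linarith
  obtain ⟨a, ha, hat⟩ := hf.exists_tendsto_abs_sub hc (fun n => hWu _ (hW n) (hxW n)) hcau
  refine ⟨a, ha, fun W' hW' ε hε => ?_⟩
  have hpt : Tendsto (fun n : ℕ => f |a - x n| + (1 / 2 : ℝ) ^ n / 2) atTop (𝓝 0) := by
    simpa using hat.add ((tendsto_pow_atTop_nhds_zero_of_lt_one (by norm_num : (0 : ℝ) ≤ 1 / 2)
      (by norm_num)).div_const 2)
  obtain ⟨n, hn⟩ := (hpt.eventually (gt_mem_nhds hε)).exists
  obtain ⟨z, ⟨hz1, hz2⟩, hzq⟩ := hnear _ (hinter _ hW' _ (hW n)) (e n ^ 2) (pow_pos (he n) 2)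
  refine ⟨z, hz1, ?_⟩
  have h1 := hxb n z hz2 hzq
  rw [hce] at h1
  have h3 : |z - a| ≤ |z - x n| + |a - x n| := by
    rw [abs_sub_comm a (x n)]
    exact abs_sub_le_add_abs_sub _ _ _
  have h4 := hf.monotone h3
  rw [map_add] at h4
  linarith

/-- The preimage under `g` of a ball around `φ g`, cut down to `[0, u]`, is a convex member of `U`.
The cluster point is `f |·|`-close to it, and `|g y| ≤ f |y|` turns this into closeness of `g a` to
`φ g`. -/
theorem DualNonneg.exists_apply_eq_of_ultrafilter {f : StrongDual ℝ F} (hf : DualNonneg f)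
    (hF : IsDedekindComplete F) (hc : ¬ CZeroEmbeds F) {u : F} (hu : 0 ≤ u) {U : Ultrafilter F}
    (hU : Set.Icc 0 u ∈ U) {φ : StrongDual ℝ F → ℝ} (hφ : ∀ g : StrongDual ℝ F, Tendsto g U (𝓝 (φ g))) :
    ∃ a ∈ Set.Icc 0 u, ∀ g : StrongDual ℝ F, (∀ y, |g y| ≤ f |y|) → g a = φ g := by
  obtain ⟨a, ha, h⟩ := hf.exists_cluster_of_convex hF hc hu
    (𝒲 := {W | Convex ℝ W ∧ W ⊆ Set.Icc 0 u ∧ W ∈ U})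
    ⟨Set.Icc 0 u, convex_Icc 0 u, subset_rfl, hU⟩
    (fun W hW => U.nonempty_of_mem hW.2.2) (fun W hW => hW.2.1) (fun W hW => hW.1)
    (fun W hW W' hW' => ⟨hW.1.inter hW'.1, Set.inter_subset_left.trans hW.2.1,
      U.inter_sets hW.2.2 hW'.2.2⟩)
  refine ⟨a, ha, fun g hg => eq_of_abs_sub_le_all fun ε hε => ?_⟩
  have hW : g ⁻¹' Metric.closedBall (φ g) (ε / 2) ∈ U :=
    hφ g (Metric.closedBall_mem_nhds _ (half_pos hε))
  obtain ⟨z, ⟨hz, -⟩, hza⟩ := h (g ⁻¹' Metric.closedBall (φ g) (ε / 2) ∩ Set.Icc 0 u)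
    ⟨((convex_closedBall _ _).linear_preimage g.toLinearMap).inter (convex_Icc 0 u),
      Set.inter_subset_right, U.inter_sets hW hU⟩ (ε / 2) (half_pos hε)
  have h1 : |g z - φ g| ≤ ε / 2 := hz
  have h2 := (hg (z - a)).trans hza
  rw [map_sub] at h2
  rw [abs_le] at *
  constructor <;> linarith

end OrderInterval

/-! ### Weak compactness of order intervals -/

section WeakCompactness

variable {F : Type*} [NormedAddCommGroup F] [NormedSpace ℝ F] [Lattice F] [IsOrderedAddMonoid F]
  [IsOrderedModule ℝ F] [HasSolidNorm F] [CompleteSpace F]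

/-- Solutions for a single `f` are not unique, so the least one, `z f`, is chosen. Then `z` is
monotone along sums of positive functionals, and its range is directed with a norm limit `a`. As `z
(f₀ + f)` solves the problem for `f`, the limit `a` does so for every positive `f`, and each `g` is
dominated by some such `f`. -/
theorem exists_forall_apply_eq_of_ultrafilter (hF : IsDedekindComplete F) (hc : ¬ CZeroEmbeds F)
    {u : F} (hu : 0 ≤ u) {U : Ultrafilter F} (hU : Set.Icc 0 u ∈ U) {φ : StrongDual ℝ F → ℝ}
    (hφ : ∀ g : StrongDual ℝ F, Tendsto g U (𝓝 (φ g))) : ∃ a ∈ Set.Icc 0 u, ∀ g, g a = φ g := by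
  have hIcc : ∀ z ∈ Set.Icc 0 u, ‖z‖ ≤ ‖u‖ := fun z hz => norm_le_norm_of_nonneg_of_le hz.1 hz.2
  let C : StrongDual ℝ F → Set F := fun f =>
    {x | x ∈ Set.Icc 0 u ∧ ∀ g : StrongDual ℝ F, (∀ y, |g y| ≤ f |y|) → g x = φ g}
  have hCne : ∀ f, DualNonneg f → (C f).Nonempty := fun f hf => by
    obtain ⟨a, ha, h⟩ := hf.exists_apply_eq_of_ultrafilter hF hc hu hU hφ
    exact ⟨a, ha, h⟩
  have hCcl : ∀ f, IsClosed (C f) := fun f => by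
    have : C f = Set.Icc 0 u ∩ ⋂ (g : StrongDual ℝ F) (_ : ∀ y, |g y| ≤ f |y|),
        {x | g x = φ g} := by
      ext x; simp [C]
    rw [this]
    exact isClosed_Icc.inter (isClosed_iInter fun g => isClosed_iInter fun _ =>
      isClosed_eq g.continuous continuous_const)
  have hCanti : ∀ f f', (∀ y, 0 ≤ y → f y ≤ f' y) → C f' ⊆ C f := fun f f' h x hx =>
    ⟨hx.1, fun g hg => hx.2 g fun y => (hg y).trans (h _ (abs_nonneg y))⟩
  have hCinf : ∀ f, DualNonneg f → ∀ x ∈ C f, ∀ y ∈ C f, x ⊓ y ∈ C f := by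
    intro f hf x hx y hy
    -- Two solutions agree on every functional dominated by `f`, one of which attains `f |x - y|`.
    have h0 : f |x - y| = 0 := by
      obtain ⟨g, hg, hgx⟩ := hf.exists_abs_le_apply_eq_abs (x - y)
      rw [← hgx, map_sub, hx.2 g hg, hy.2 g hg, sub_self]
    refine ⟨⟨le_inf hx.1.1 hy.1.1, inf_le_left.trans hx.1.2⟩, fun g hg => ?_⟩
    have h1 : |x - x ⊓ y| ≤ |x - y| := by
      rw [abs_of_nonneg (sub_nonneg.2 inf_le_left), sub_inf, sub_self]
      exact sup_le (abs_nonneg _) (le_abs_self _)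
    have h2 := (hg (x - x ⊓ y)).trans (hf.monotone h1)
    rw [h0, map_sub, hx.2 g hg] at h2
    linarith [abs_nonpos_iff.1 h2]
  have hmin : ∀ f, DualNonneg f → ∃ z ∈ C f, z ∈ lowerBounds (C f) := fun f hf => by
    obtain ⟨z, hz, hzc⟩ := exists_mem_lowerBounds_closure_of_directedOn hc (hCne f hf)
      (fun x hx y hy => ⟨x ⊓ y, hCinf f hf x hx y hy, inf_le_left, inf_le_right⟩)
      (fun x hx => hIcc x hx.1)
    exact ⟨z, (hCcl f).closure_subset hzc, hz⟩
  choose! z hzC hzl using hmin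
  have hzmono : ∀ f f', DualNonneg f → DualNonneg f' → z f ≤ z (f + f') := fun f f' hf hf' =>
    hzl f hf (hCanti f (f + f') (fun y hy => le_add_of_nonneg_right (hf' y hy))
      (hzC _ (hf.add hf')))
  obtain ⟨a, ha, hac⟩ := exists_mem_upperBounds_closure_of_directedOn hc
    (D := z '' {f | DualNonneg f}) ⟨_, 0, fun x _ => le_rfl, rfl⟩ (by
      rintro _ ⟨f, hf, rfl⟩ _ ⟨f', hf', rfl⟩
      exact ⟨z (f + f'), ⟨_, DualNonneg.add hf hf', rfl⟩, hzmono f f' hf hf',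
        by rw [add_comm]; exact hzmono f' f hf' hf⟩) (M := ‖u‖) (by
      rintro _ ⟨f, hf, rfl⟩
      exact hIcc _ (hzC f hf).1)
  refine ⟨a, isClosed_Icc.closure_subset_iff.2 ?_ hac, fun g => ?_⟩
  · rintro _ ⟨f, hf, rfl⟩
    exact (hzC f hf).1
  · obtain ⟨f, hf, hgf⟩ := g.exists_dualNonneg_abs_le
    have haC : a ∈ closure (C f) := Metric.mem_closure_iff.2 fun ε hε => by
      obtain ⟨_, ⟨f₀, hf₀, rfl⟩, hd⟩ := Metric.mem_closure_iff.1 hac ε hε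
      refine ⟨z (f₀ + f), hCanti f _ (fun y hy => le_add_of_nonneg_left (hf₀ y hy))
        (hzC _ (DualNonneg.add hf₀ hf)), ?_⟩
      rw [dist_eq_norm] at *
      exact (norm_le_norm_of_nonneg_of_le (sub_nonneg.2 (ha ⟨_, DualNonneg.add hf₀ hf, rfl⟩))
        (sub_le_sub_left (hzmono f₀ f hf₀ hf) a)).trans_lt hd
    exact ((hCcl f).closure_subset haC).2 g hgf

/-- Order intervals of a Dedekind complete Banach lattice without a copy of `c₀` are weakly
compact. -/
theorem isCompact_toWeakSpace_image_Icc_zero (hF : IsDedekindComplete F) (hc : ¬ CZeroEmbeds F)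
    {u : F} (hu : 0 ≤ u) : IsCompact (toWeakSpace ℝ F '' Set.Icc 0 u) := by
  rw [isCompact_iff_ultrafilter_le_nhds]
  intro V hV
  let U : Ultrafilter F := V.map (toWeakSpace ℝ F).symm
  have hU : Set.Icc 0 u ∈ U := by
    refine Ultrafilter.mem_map.2 (mem_of_superset (le_principal_iff.1 hV) ?_)
    rintro _ ⟨x, hx, rfl⟩
    simpa using hx
  have hlim : ∀ g : StrongDual ℝ F, ∃ c, Tendsto g U (𝓝 c) := fun g => by
    have hm : Metric.closedBall (0 : ℝ) (‖g‖ * ‖u‖) ∈ U.map g := by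
      refine Ultrafilter.mem_map.2 (mem_of_superset hU fun x hx => ?_)
      rw [Set.mem_preimage, mem_closedBall_zero_iff]
      exact (g.le_opNorm x).trans (mul_le_mul_of_nonneg_left
        (norm_le_norm_of_nonneg_of_le hx.1 hx.2) (norm_nonneg g))
    obtain ⟨c, -, hcl⟩ := (isCompact_closedBall (0 : ℝ) (‖g‖ * ‖u‖)).ultrafilter_le_nhds
      (U.map g) (le_principal_iff.2 hm)
    exact ⟨c, hcl⟩
  choose φ hφ using hlim
  obtain ⟨a, ha, h⟩ := exists_forall_apply_eq_of_ultrafilter hF hc hu hU hφ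
  refine ⟨toWeakSpace ℝ F a, ⟨a, ha, rfl⟩, ?_⟩
  have hinj : Function.Injective (topDualPairing ℝ F).flip := fun x y hxy => by
    by_contra hne
    obtain ⟨g, hg⟩ := SeparatingDual.exists_separating_of_ne (R := ℝ) hne
    exact hg (LinearMap.congr_fun hxy g)
  have ht : Tendsto (id : WeakSpace ℝ F → WeakSpace ℝ F) V (𝓝 (toWeakSpace ℝ F a)) := by
    refine (WeakBilin.tendsto_iff_forall_eval_tendsto _ hinj).2 fun g => ?_
    have h1 := hφ g
    rw [← h g] at h1
    exact h1
  exact ht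

theorem IsOrderBoundedSet.isRelativelyWeaklyCompact (hF : IsDedekindComplete F)
    (hc : ¬ CZeroEmbeds F) {B : Set F} (hB : IsOrderBoundedSet B) :
    IsRelativelyWeaklyCompact B := by
  obtain ⟨a, b, hab⟩ := hB
  rcases B.eq_empty_or_nonempty with rfl | ⟨x, hx⟩
  · simp [IsRelativelyWeaklyCompact]
  have hu : 0 ≤ b - a := sub_nonneg.2 ((hab hx).1.trans (hab hx).2)
  have hcomp := (isCompact_toWeakSpace_image_Icc_zero hF hc hu).image
    (continuous_const_add (toWeakSpace ℝ F a))
  refine hcomp.of_isClosed_subset isClosed_closure (closure_minimal ?_ hcomp.isClosed)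
  rintro _ ⟨y, hy, rfl⟩
  refine ⟨toWeakSpace ℝ F (y - a), ⟨y - a, ⟨sub_nonneg.2 (hab hy).1,
    sub_le_sub_right (hab hy).2 a⟩, rfl⟩, ?_⟩
  simp

end WeakCompactness

theorem mainTheorem2
    {E : Type*} [NormedAddCommGroup E] [NormedSpace ℝ E] [Lattice E] [IsOrderedAddMonoid E]
    [IsOrderedModule ℝ E] [HasSolidNorm E] [CompleteSpace E]
    {F : Type*} [NormedAddCommGroup F] [NormedSpace ℝ F] [Lattice F] [IsOrderedAddMonoid F]
    [IsOrderedModule ℝ F] [HasSolidNorm F] [CompleteSpace F]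
    (hF : IsDedekindComplete F) (hc : ¬ CZeroEmbeds F)
    (T : E →ₗ[ℝ] F) (hT : IsOrderBoundedOperator T) :
    IsBWeaklyCompact T ∧ ∃ R : E →ₗ[ℝ] F, IsOperatorModulus T R ∧ IsBWeaklyCompact R := by
  obtain ⟨R, hR⟩ := exists_isOperatorModulus hF hT
  have hR0 : ∀ x, 0 ≤ x → 0 ≤ R x := fun x hx => hR.apply_nonneg hx
  refine ⟨fun A hA => ?_, R, hR, fun A hA => ?_⟩
  · obtain ⟨a, b, h1⟩ := isOrderBoundedSet_image_of_isBOrderBounded hc hR0 hA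
    -- By definition of the operator order, `hR.le` is exactly the positivity of `R - T`.
    obtain ⟨a', b', h2⟩ := isOrderBoundedSet_image_of_isBOrderBounded hc (S := R - T) hR.le hA
    refine IsOrderBoundedSet.isRelativelyWeaklyCompact hF hc ⟨a - b', b - a', ?_⟩
    rintro _ ⟨x, hx, rfl⟩
    have h3 := h1 ⟨x, hx, rfl⟩
    have h4 := h2 ⟨x, hx, rfl⟩
    rw [show T x = R x - (R - T) x by simp]
    exact ⟨sub_le_sub h3.1 h4.2, sub_le_sub h3.2 h4.1⟩
  · exact IsOrderBoundedSet.isRelativelyWeaklyCompact hF hc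
      (isOrderBoundedSet_image_of_isBOrderBounded hc hR0 hA)
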